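/- Let $X$ be a Polish space with a metric $\rho$ inducing its topology, let $d\ge 1$, and let $\mathcal P(X)$ be the set of Borel probability measures on $X$. For $\boldsymbol\mu=(\mu_1,\dots,\mu_d)\in\mathcal P(X)^d$ put $\bar\mu=\frac1d\sum_{j}\mu_j$ and $\boldsymbol\mu'=\big(\frac{\mathrm d\mu_1}{\mathrm d\bar\mu},\dots,\frac{\mathrm d\mu_d}{\mathrm d\bar\mu}\big)$. For $\boldsymbol\mu,\boldsymbol\nu\in\mathcal P(X)^d$ let $$\Pi(\boldsymbol\mu,\boldsymbol\nu)=\Big\{\bar\mu\otimes\kappa \;:\; \kappa \text{ a stochastic kernel from } X \text{ to } X,\ \int_X\kappa(x;B)\,\mu_j(\mathrm dx)\ge\nu_j(B)\text{ for all Borel } B\subseteq X,\ 1\le j\le d\Big\}$$ (since all $\mu_j,\nu_j$ are probability measures, the inequalities are in fact equalities). For $c:X\times X\to[0,\infty]$ measurable let $$\mathcal I_c(\boldsymbol\mu,\boldsymbol\nu)=\inf_{\pi\in\Pi(\boldsymbol\mu,\boldsymbol\nu)}\int_{X\times X}c\,\mathrm d\pi\in[0,\infty],$$ with $\inf\emptyset=\infty$.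 1. If $c:X\times X\to[0,\infty]$ is continuous and symmetric ($c(x,y)=c(y,x)$ for all $x,y$), and both $\Pi(\boldsymbol\mu,\boldsymbol\nu)$ and $\Pi(\boldsymbol\nu,\boldsymbol\mu)$ are nonempty, then $$\mathcal I_c(\boldsymbol\mu,\boldsymbol\nu)=\mathcal I_c(\boldsymbol\nu,\boldsymbol\mu).$$ 2. Let $1\le p<\infty$ and $\mathcal W_p(\boldsymbol\mu,\boldsymbol\nu)=\mathcal I_{\rho^p}(\boldsymbol\mu,\boldsymbol\nu)^{1/p}$. For a probability measure $P$ on $\mathbb R_+^d$ let $\mathcal E_P$ be the set of all $\boldsymbol\mu\in\mathcal P(X)^d$ with $\bar\mu\circ(\boldsymbol\mu')^{-1}=P$. Then $\mathcal W_p$ is an extended metric on $\mathcal E_P$: for all $\boldsymbol\mu,\boldsymbol\nu,\boldsymbol\xi\in\mathcal E_P$, $$\mathcal W_p(\boldsymbol\mu,\boldsymbol\nu)=\mathcal W_p(\boldsymbol\nu,\boldsymbol\mu),\qquad \mathcal W_p(\boldsymbol\mu,\boldsymbol\nu)=0\iff\boldsymbol\mu=\boldsymbol\nu,\qquad \mathcal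 W_p(\boldsymbol\mu,\boldsymbol\xi)\le\mathcal W_p(\boldsymbol\mu,\boldsymbol\nu)+\mathcal W_p(\boldsymbol\nu,\boldsymbol\xi).$$ Moreover $\mathcal W_p(\boldsymbol\mu,\boldsymbol\nu)<\infty$ whenever $\boldsymbol\mu,\boldsymbol\nu\in\mathcal E_P$ satisfy $\int_X\rho(x,x_0)^p\,\bar\mu(\mathrm dx)<\infty$ and $\int_X\rho(x,x_1)^p\,\bar\nu(\mathrm dx)<\infty$ for some $x_0,x_1\in X$; hence $\mathcal W_p$ is a metric on the set of those elements of $\mathcal E_P$ whose average measure has a finite $p$-th moment. -/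

import Mathlib

open MeasureTheory ProbabilityTheory
open scoped NNReal ENNReal

namespace SimTransport

noncomputable section

/-- The arithmetic average `(μ₁ + ⋯ + μ_d) / d` of a `d`-tuple of probability measures. -/
def avg {X : Type*} [MeasurableSpace X] {d : ℕ} (μ : Fin d → ProbabilityMeasure X) :
    Measure X :=
  (d : ℝ≥0∞)⁻¹ • ∑ j, (μ j : Measure X)

/-- The vector of Radon-Nikodym derivatives `dμ_j / dμ̄`, as a map into the nonnegative
orthant. -/
def density {X : Type*} [MeasurableSpace X] {d : ℕ} (μ : Fin d → ProbabilityMeasure X)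
    (x : X) : Fin d → ℝ≥0 :=
  fun j => ((μ j : Measure X).rnDeriv (avg μ) x).toNNReal

/-- Simultaneous transport kernels: stochastic kernels `κ` whose push-forward
`∫ κ(x; ·) μ_j(dx)` covers `ν_j` for every `j`. -/
def kernels {X Y : Type*} [MeasurableSpace X] [MeasurableSpace Y] {d : ℕ}
    (μ : Fin d → ProbabilityMeasure X) (ν : Fin d → ProbabilityMeasure Y) :
    Set (Kernel X Y) :=
  {κ | IsMarkovKernel κ ∧ ∀ j, (ν j : Measure Y) ≤ (μ j : Measure X).bind κ}

/-- Simultaneous transport plans: the measures `μ̄ ⊗ κ` with `κ` a simultaneous transport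
kernel. -/
def plans {X Y : Type*} [MeasurableSpace X] [MeasurableSpace Y] {d : ℕ}
    (μ : Fin d → ProbabilityMeasure X) (ν : Fin d → ProbabilityMeasure Y) :
    Set (Measure (X × Y)) :=
  {π | ∃ κ ∈ kernels μ ν, π = (avg μ).compProd κ}

/-- The optimal simultaneous transport cost; it is `∞` if there is no transport plan. -/
def minCost {X Y : Type*} [MeasurableSpace X] [MeasurableSpace Y] {d : ℕ}
    (c : X → Y → ℝ≥0∞)
    (μ : Fin d → ProbabilityMeasure X) (ν : Fin d → ProbabilityMeasure Y) : ℝ≥0∞ :=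
  ⨅ π ∈ plans μ ν, ∫⁻ z, c z.1 z.2 ∂π

/-- The class of all `μ` such that the law of the density vector under the average
measure is `P`. -/
def eqClass (X : Type*) [MeasurableSpace X] {d : ℕ}
    (P : ProbabilityMeasure (Fin d → ℝ≥0)) : Set (Fin d → ProbabilityMeasure X) :=
  {μ | (avg μ).map (density μ) = (P : Measure (Fin d → ℝ≥0))}

/-- Tuples whose average has a finite `p`-th moment. -/
def finiteMoment (X : Type*) [PseudoEMetricSpace X] [MeasurableSpace X] (d : ℕ) (p : ℝ) :
    Set (Fin d → ProbabilityMeasure X) :=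
  {μ | ∃ x₀ : X, ∫⁻ x, edist x x₀ ^ p ∂(avg μ) < ∞}

/-- The simultaneous Wasserstein cost, with values in `[0, ∞]`. -/
def wasserstein {X : Type*} [PseudoEMetricSpace X] [MeasurableSpace X] {d : ℕ} (p : ℝ)
    (μ ν : Fin d → ProbabilityMeasure X) : ℝ≥0∞ :=
  minCost (fun x y => edist x y ^ p) μ ν ^ (1 / p)

end

end SimTransport

/-!
The point is that simultaneous transport between tuples with equally distributed density vectors is
ordinary transport of the averages, restricted to couplings that preserve the density vector.

Let `π = avg μ ⊗ₘ κ` be a plan from `μ` to `ν`. Since `κ` carries each `μ j` to `ν j`, the density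
of `ν j` at the second coordinate is the `π`-conditional expectation of the density of `μ j` at the
first one. Hence the `π`-mean square of the difference of the two densities is the second moment of
the density of `μ j` minus that of `ν j` (`lintegral_sub_sq_add`). If there are plans in both
directions, or if the density vectors have the same law, these second moments agree, so the density
vectors agree `π`-almost everywhere (`density_ae_eq_of_mem_plans`). Conversely, every coupling of
the averages along which the density vectors agree is a plan, its disintegration being a transport
kernel (`mem_plans_of_coupling`). This last condition is invariant under exchanging coordinates,
and so for a symmetric cost the two minimal costs coincide; only measurability of the cost matters.

The remaining properties of `wasserstein` follow from classical arguments. The triangle inequality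
is Minkowski's inequality on the gluing of two plans (`wasserstein_triangle`). If `wasserstein`
vanishes, Markov's inequality along plans of small cost shows that `μ j` and `ν j` have
Lévy-Prokhorov distance zero (`eq_of_wasserstein_eq_zero`). Plans between tuples with the same law of
densities exist: couple the averages conditionally independently given a common density vector
(`plans_nonempty_of_mem_eqClass`); finite moments make the cost of any plan finite
(`wasserstein_lt_top`).
-/

namespace SimTransport

variable {X Y Z : Type*} [MeasurableSpace X] [MeasurableSpace Y] [MeasurableSpace Z] {d : ℕ}

/-! ### The average measure and the density vector -/

lemma lintegral_avg (μ : Fin d → ProbabilityMeasure X) (f : X → ℝ≥0∞) :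
    ∫⁻ x, f x ∂(avg μ) = (d : ℝ≥0∞)⁻¹ * ∑ j, ∫⁻ x, f x ∂(μ j : Measure X) := by
  simp [avg, lintegral_smul_measure]

lemma avg_apply (μ : Fin d → ProbabilityMeasure X) (s : Set X) :
    avg μ s = (d : ℝ≥0∞)⁻¹ * ∑ j, (μ j : Measure X) s := by
  simp [avg]

instance isProbabilityMeasure_avg [NeZero d] (μ : Fin d → ProbabilityMeasure X) :
    IsProbabilityMeasure (avg μ) :=
  ⟨by simp [avg_apply, ENNReal.inv_mul_cancel, NeZero.ne d]⟩

lemma le_smul_avg [NeZero d] (μ : Fin d → ProbabilityMeasure X) (j : Fin d) :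
    (μ j : Measure X) ≤ (d : ℝ≥0∞) • avg μ := by
  have hd : (d : ℝ≥0∞) ≠ 0 := by simp [NeZero.ne d]
  rw [avg, smul_smul, ENNReal.mul_inv_cancel hd (by simp), one_smul]
  refine Measure.le_iff.2 fun s _ => ?_
  rw [Measure.finsetSum_apply]
  exact Finset.single_le_sum (f := fun j => (μ j : Measure X) s) (fun _ _ => zero_le)
    (Finset.mem_univ j)

lemma absolutelyContinuous_avg [NeZero d] (μ : Fin d → ProbabilityMeasure X) (j : Fin d) :
    (μ j : Measure X) ≪ avg μ :=
  (Measure.absolutelyContinuous_of_le (le_smul_avg μ j)).trans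
    (Measure.smul_absolutelyContinuous)

@[fun_prop]
lemma measurable_density (μ : Fin d → ProbabilityMeasure X) : Measurable (density μ) :=
  measurable_pi_lambda _ fun _ => (Measure.measurable_rnDeriv _ _).ennreal_toNNReal

@[fun_prop]
lemma measurable_density_apply (μ : Fin d → ProbabilityMeasure X) (j : Fin d) :
    Measurable fun x => density μ x j :=
  (Measure.measurable_rnDeriv _ _).ennreal_toNNReal

lemma coe_density_ae_eq [NeZero d] (μ : Fin d → ProbabilityMeasure X) (j : Fin d) :
    (fun x => (density μ x j : ℝ≥0∞)) =ᵐ[avg μ] (μ j : Measure X).rnDeriv (avg μ) := by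
  filter_upwards [Measure.rnDeriv_lt_top (μ j : Measure X) (avg μ)] with x hx
  exact ENNReal.coe_toNNReal hx.ne

lemma withDensity_density [NeZero d] (μ : Fin d → ProbabilityMeasure X) (j : Fin d) :
    (avg μ).withDensity (fun x => (density μ x j : ℝ≥0∞)) = μ j := by
  rw [withDensity_congr_ae (coe_density_ae_eq μ j),
    Measure.withDensity_rnDeriv_eq _ _ (absolutelyContinuous_avg μ j)]

lemma lintegral_density_mul [NeZero d] (μ : Fin d → ProbabilityMeasure X) (j : Fin d)
    {f : X → ℝ≥0∞} (hf : Measurable f) :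
    ∫⁻ x, density μ x j * f x ∂(avg μ) = ∫⁻ x, f x ∂(μ j : Measure X) := by
  conv_rhs => rw [← withDensity_density μ j]
  rw [lintegral_withDensity_eq_lintegral_mul _ (by fun_prop) hf]
  rfl

/-- The densities are square integrable, since `μ j ≤ d • avg μ` bounds them by `d`. -/
lemma lintegral_density_sq_ne_top [NeZero d] (μ : Fin d → ProbabilityMeasure X) (j : Fin d) :
    ∫⁻ x, (density μ x j : ℝ≥0∞) * density μ x j ∂(avg μ) ≠ ∞ := by
  have hle : ∫⁻ x, density μ x j ∂(μ j : Measure X) ≤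
      ∫⁻ x, density μ x j ∂((d : ℝ≥0∞) • avg μ) := lintegral_mono' (le_smul_avg μ j) le_rfl
  have h1 : ∫⁻ x, density μ x j ∂(avg μ) = 1 := by
    simpa using lintegral_density_mul μ j (f := fun _ => 1) measurable_const
  rw [lintegral_density_mul μ j (by fun_prop)]
  refine (hle.trans_lt ?_).ne
  rw [lintegral_smul_measure, h1]
  simp

/-! ### Transport kernels and transport plans -/

lemma bind_eq_of_mem_kernels {μ : Fin d → ProbabilityMeasure X}
    {ν : Fin d → ProbabilityMeasure Y} {κ : Kernel X Y} (hκ : κ ∈ kernels μ ν) (j : Fin d) :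
    (μ j : Measure X).bind κ = ν j := by
  have := hκ.1
  exact (Measure.eq_of_le_of_isProbabilityMeasure (hκ.2 j)).symm

lemma avg_bind_eq_of_mem_kernels {μ : Fin d → ProbabilityMeasure X}
    {ν : Fin d → ProbabilityMeasure Y} {κ : Kernel X Y} (hκ : κ ∈ kernels μ ν) :
    (avg μ).bind κ = avg ν := by
  ext s hs
  rw [Measure.bind_apply hs κ.aemeasurable, lintegral_avg, avg_apply]
  congr 1
  refine Finset.sum_congr rfl fun j _ => ?_
  rw [← bind_eq_of_mem_kernels hκ j, Measure.bind_apply hs κ.aemeasurable]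

/-- Weighting the plan `avg μ ⊗ₘ κ` by the `j`-th density of `μ` gives `μ j ⊗ₘ κ`, whose second
marginal is `μ j` transported by `κ`. -/
lemma lintegral_compProd_density_mul [NeZero d] (μ : Fin d → ProbabilityMeasure X)
    (κ : Kernel X Y) [IsMarkovKernel κ] (j : Fin d) {h : Y → ℝ≥0∞} (hh : Measurable h) :
    ∫⁻ z, density μ z.1 j * h z.2 ∂(avg μ ⊗ₘ κ) = ∫⁻ y, h y ∂((μ j : Measure X).bind κ) := by
  rw [Measure.lintegral_compProd (by fun_prop),
    Measure.lintegral_bind κ.aemeasurable hh.aemeasurable,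
    ← lintegral_density_mul μ j hh.lintegral_kernel]
  refine lintegral_congr fun x => ?_
  exact lintegral_const_mul (density μ x j : ℝ≥0∞) hh

/-- A coupling of the average measures along which the density vectors agree is a transport
plan: its disintegration is a transport kernel. -/
lemma mem_plans_of_coupling [NeZero d] [StandardBorelSpace Y] {μ : Fin d → ProbabilityMeasure X}
    {ν : Fin d → ProbabilityMeasure Y} {π : Measure (X × Y)} (h₁ : π.fst = avg μ)
    (h₂ : π.snd = avg ν) (h : ∀ᵐ z ∂π, density μ z.1 = density ν z.2) : π ∈ plans μ ν := by
  have : IsProbabilityMeasure π := by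
    have : IsProbabilityMeasure π.fst := h₁ ▸ inferInstance
    exact ⟨by rw [← Measure.fst_univ, measure_univ]⟩
  have : Nonempty Y := (avg ν).nonempty_of_neZero
  have hπ : π = avg μ ⊗ₘ π.condKernel := by rw [← h₁, π.disintegrate]
  refine ⟨π.condKernel, ⟨inferInstance, fun j => le_of_eq ?_⟩, hπ⟩
  ext s hs
  have hm : Measurable (s.indicator (1 : Y → ℝ≥0∞)) := measurable_one.indicator hs
  rw [← lintegral_indicator_one hs, ← lintegral_indicator_one hs,
    ← lintegral_compProd_density_mul μ _ j hm, ← hπ, ← lintegral_density_mul ν j hm, ← h₂,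
    Measure.snd, lintegral_map (by fun_prop) measurable_snd]
  refine lintegral_congr_ae ?_
  filter_upwards [h] with z hz
  rw [hz]

lemma fst_of_mem_plans [NeZero d] {μ : Fin d → ProbabilityMeasure X}
    {ν : Fin d → ProbabilityMeasure Y} {π : Measure (X × Y)} (hπ : π ∈ plans μ ν) :
    π.fst = avg μ := by
  obtain ⟨κ, hκ, rfl⟩ := hπ
  have := hκ.1
  exact Measure.fst_compProd _ _

lemma snd_of_mem_plans [NeZero d] {μ : Fin d → ProbabilityMeasure X}
    {ν : Fin d → ProbabilityMeasure Y} {π : Measure (X × Y)} (hπ : π ∈ plans μ ν) :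
    π.snd = avg ν := by
  obtain ⟨κ, hκ, rfl⟩ := hπ
  have := hκ.1
  rw [Measure.snd_compProd]
  exact avg_bind_eq_of_mem_kernels hκ

lemma ofReal_sub_sq_add (a b : ℝ≥0) :
    ENNReal.ofReal (((a : ℝ) - b) ^ 2) + 2 * (a * b) = (a * a + b * b : ℝ≥0∞) := by
  rw [← ENNReal.toReal_eq_toReal_iff' (by finiteness) (by finiteness),
    ENNReal.toReal_add (by finiteness) (by finiteness),
    ENNReal.toReal_add (by finiteness) (by finiteness), ENNReal.toReal_ofReal (sq_nonneg _)]
  simp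
  ring

/-- The orthogonality relation behind the fact that along a plan the density of `ν` is the
conditional expectation of the density of `μ` given the second coordinate. -/
lemma lintegral_sub_sq_add [NeZero d] {μ : Fin d → ProbabilityMeasure X}
    {ν : Fin d → ProbabilityMeasure Y} {π : Measure (X × Y)} (hπ : π ∈ plans μ ν) (j : Fin d) :
    ∫⁻ z, ENNReal.ofReal (((density μ z.1 j : ℝ) - density ν z.2 j) ^ 2) ∂π
        + ∫⁻ y, (density ν y j : ℝ≥0∞) * density ν y j ∂(avg ν)
      = ∫⁻ x, (density μ x j : ℝ≥0∞) * density μ x j ∂(avg μ) := by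
  have hX : ∫⁻ z, (density μ z.1 j : ℝ≥0∞) * density μ z.1 j ∂π
      = ∫⁻ x, (density μ x j : ℝ≥0∞) * density μ x j ∂(avg μ) := by
    rw [← fst_of_mem_plans hπ, Measure.fst, lintegral_map (by fun_prop) measurable_fst]
  have hY : ∫⁻ z, (density ν z.2 j : ℝ≥0∞) * density ν z.2 j ∂π
      = ∫⁻ y, (density ν y j : ℝ≥0∞) * density ν y j ∂(avg ν) := by
    rw [← snd_of_mem_plans hπ, Measure.snd, lintegral_map (by fun_prop) measurable_snd]
  have hXY : ∫⁻ z, (density μ z.1 j : ℝ≥0∞) * density ν z.2 j ∂π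
      = ∫⁻ y, (density ν y j : ℝ≥0∞) * density ν y j ∂(avg ν) := by
    obtain ⟨κ, hκ, rfl⟩ := hπ
    have := hκ.1
    rw [lintegral_compProd_density_mul μ κ j (h := fun y => (density ν y j : ℝ≥0∞)) (by fun_prop),
      bind_eq_of_mem_kernels hκ, lintegral_density_mul ν j (by fun_prop)]
  have key := lintegral_congr (μ := π)
    fun z : X × Y => ofReal_sub_sq_add (density μ z.1 j) (density ν z.2 j)
  rw [lintegral_add_right _ (by fun_prop), lintegral_add_right _ (by fun_prop),
    lintegral_const_mul _ (by fun_prop), hX, hY, hXY, two_mul, ← add_assoc] at key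
  exact (ENNReal.add_left_inj (lintegral_density_sq_ne_top ν j)).1 key

/-- If a plan from `μ` to `ν` does not decrease the second moments of the densities, then it only
moves mass between points with equal density vectors. -/
lemma density_ae_eq_of_mem_plans [NeZero d] {μ : Fin d → ProbabilityMeasure X}
    {ν : Fin d → ProbabilityMeasure Y} {π : Measure (X × Y)} (hπ : π ∈ plans μ ν)
    (hle : ∀ j, ∫⁻ x, (density μ x j : ℝ≥0∞) * density μ x j ∂(avg μ) ≤
      ∫⁻ y, (density ν y j : ℝ≥0∞) * density ν y j ∂(avg ν)) :
    ∀ᵐ z ∂π, density μ z.1 = density ν z.2 := by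
  have h0 (j : Fin d) : ∀ᵐ z ∂π, density μ z.1 j = density ν z.2 j := by
    have hz : ∫⁻ z, ENNReal.ofReal (((density μ z.1 j : ℝ) - density ν z.2 j) ^ 2) ∂π = 0 := by
      have h := (lintegral_sub_sq_add hπ j).trans_le (hle j)
      exact nonpos_iff_eq_zero.1 (ENNReal.le_of_add_le_add_right
        (lintegral_density_sq_ne_top ν j) (by rwa [zero_add]))
    rw [lintegral_eq_zero_iff (by fun_prop)] at hz
    filter_upwards [hz] with z hz
    have h : ((density μ z.1 j : ℝ) - density ν z.2 j) ^ 2 ≤ 0 := ENNReal.ofReal_eq_zero.1 hz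
    exact NNReal.coe_injective (sub_eq_zero.1 (pow_eq_zero_iff two_ne_zero |>.1
      (h.antisymm (sq_nonneg _))))
  filter_upwards [ae_all_iff.2 h0] with z hz
  exact funext hz

lemma lintegral_density_sq_le [NeZero d] {μ : Fin d → ProbabilityMeasure X}
    {ν : Fin d → ProbabilityMeasure Y} (h : (plans μ ν).Nonempty) (j : Fin d) :
    ∫⁻ y, (density ν y j : ℝ≥0∞) * density ν y j ∂(avg ν) ≤
      ∫⁻ x, (density μ x j : ℝ≥0∞) * density μ x j ∂(avg μ) := by
  obtain ⟨π, hπ⟩ := h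
  exact le_add_self.trans_eq (lintegral_sub_sq_add hπ j)

/-! ### Symmetry -/

/-- A plan which does not decrease the second moments of the densities can be reversed, because it
preserves the density vector. -/
lemma map_swap_mem_plans [NeZero d] [StandardBorelSpace X] {μ : Fin d → ProbabilityMeasure X}
    {ν : Fin d → ProbabilityMeasure Y} {π : Measure (X × Y)} (hπ : π ∈ plans μ ν)
    (hle : ∀ j, ∫⁻ x, (density μ x j : ℝ≥0∞) * density μ x j ∂(avg μ) ≤
      ∫⁻ y, (density ν y j : ℝ≥0∞) * density ν y j ∂(avg ν)) :
    π.map Prod.swap ∈ plans ν μ := by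
  refine mem_plans_of_coupling (by rw [Measure.fst_map_swap, snd_of_mem_plans hπ])
    (by rw [Measure.snd_map_swap, fst_of_mem_plans hπ]) ?_
  rw [ae_map_iff measurable_swap.aemeasurable
    (measurableSet_eq_fun (by fun_prop) (by fun_prop))]
  filter_upwards [density_ae_eq_of_mem_plans hπ hle] with z hz
  exact hz.symm

lemma minCost_le_of_symm [NeZero d] [StandardBorelSpace X] {c : X → X → ℝ≥0∞}
    (hc : Measurable fun z : X × X => c z.1 z.2) (hsymm : ∀ x y, c x y = c y x)
    {μ ν : Fin d → ProbabilityMeasure X}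
    (hle : ∀ j, ∫⁻ x, (density μ x j : ℝ≥0∞) * density μ x j ∂(avg μ) ≤
      ∫⁻ y, (density ν y j : ℝ≥0∞) * density ν y j ∂(avg ν)) :
    minCost c ν μ ≤ minCost c μ ν := by
  refine le_iInf₂ fun π hπ => ?_
  refine (iInf₂_le _ (map_swap_mem_plans hπ hle)).trans_eq ?_
  rw [lintegral_map hc measurable_swap]
  exact lintegral_congr fun z => hsymm _ _

lemma lintegral_density_sq_eq_of_mem_eqClass {P : ProbabilityMeasure (Fin d → ℝ≥0)}
    {μ : Fin d → ProbabilityMeasure X} (hμ : μ ∈ eqClass X P) (j : Fin d) :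
    ∫⁻ x, (density μ x j : ℝ≥0∞) * density μ x j ∂(avg μ)
      = ∫⁻ t, (t j : ℝ≥0∞) * t j ∂(P : Measure (Fin d → ℝ≥0)) := by
  rw [← show (avg μ).map (density μ) = P from hμ,
    lintegral_map (by fun_prop) (measurable_density μ)]

/-! ### Existence of plans -/

/-- If the density vectors of `μ` and `ν` have the same law, there is a plan from `μ` to `ν`: send
`x` to a point drawn from the conditional law of `avg ν` given that the density of `ν` equals the
density of `μ` at `x`. -/
lemma plans_nonempty_of_mem_eqClass [NeZero d] [StandardBorelSpace Y]
    {P : ProbabilityMeasure (Fin d → ℝ≥0)} {μ : Fin d → ProbabilityMeasure X}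
    {ν : Fin d → ProbabilityMeasure Y} (hμ : μ ∈ eqClass X P) (hν : ν ∈ eqClass Y P) :
    (plans μ ν).Nonempty := by
  have : Nonempty Y := (avg ν).nonempty_of_neZero
  let η : Kernel (Fin d → ℝ≥0) Y := condDistrib id (density ν) (avg ν)
  let π : Measure (X × Y) := avg μ ⊗ₘ η.comap (density μ) (measurable_density μ)
  have hlaw : π.map (Prod.map (density μ) id) = (avg ν).map fun y => (density ν y, y) := by
    have h := compProd_map_condDistrib (X := density ν) (Y := id) (μ := avg ν)
      (mβ := inferInstance) aemeasurable_id
    refine Eq.trans ?_ h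
    rw [show (avg ν).map (density ν) = P from hν, ← show (avg μ).map (density μ) = P from hμ]
    ext s hs
    rw [Measure.map_apply (by fun_prop) hs, Measure.compProd_apply (by measurability),
      Measure.compProd_apply hs, lintegral_map (Kernel.measurable_kernel_prodMk_left hs)
        (measurable_density μ)]
    rfl
  refine ⟨π, mem_plans_of_coupling (Measure.fst_compProd _ _) ?_ ?_⟩
  · have h := congrArg Measure.snd hlaw
    rwa [Measure.snd, Measure.snd, Measure.map_map (by fun_prop) (by fun_prop),
      Measure.map_map (by fun_prop) (by fun_prop),
      show (Prod.snd ∘ fun y => (density ν y, y)) = id from rfl, Measure.map_id] at h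
  · have hs : MeasurableSet {w : (Fin d → ℝ≥0) × Y | w.1 = density ν w.2} :=
      measurableSet_eq_fun (by fun_prop) (by fun_prop)
    have h : ∀ᵐ w ∂(π.map (Prod.map (density μ) id)), w.1 = density ν w.2 := by
      rw [hlaw, ae_map_iff (by fun_prop) hs]
      simp
    rwa [ae_map_iff (by fun_prop) hs] at h

/-! ### The triangle inequality -/

lemma comp_mem_kernels {μ : Fin d → ProbabilityMeasure X} {ν : Fin d → ProbabilityMeasure Y}
    {ξ : Fin d → ProbabilityMeasure Z} {κ : Kernel X Y} {η : Kernel Y Z}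
    (hκ : κ ∈ kernels μ ν) (hη : η ∈ kernels ν ξ) : η ∘ₖ κ ∈ kernels μ ξ := by
  have := hκ.1
  have := hη.1
  refine ⟨inferInstance, fun j => ?_⟩
  rw [← Measure.comp_assoc, bind_eq_of_mem_kernels hκ, bind_eq_of_mem_kernels hη]

lemma wasserstein_eq_iInf {E : Type*} [PseudoEMetricSpace E] [MeasurableSpace E]
    {p : ℝ} (hp : 1 ≤ p) (μ ν : Fin d → ProbabilityMeasure E) :
    wasserstein p μ ν
      = ⨅ κ ∈ kernels μ ν, (∫⁻ z, edist z.1 z.2 ^ p ∂(avg μ ⊗ₘ κ)) ^ (1 / p) := by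
  have hp : 0 < 1 / p := by positivity
  have h : minCost (fun x y => edist x y ^ p) μ ν
      = ⨅ κ ∈ kernels μ ν, ∫⁻ z, edist z.1 z.2 ^ p ∂(avg μ ⊗ₘ κ) :=
    le_antisymm (le_iInf₂ fun κ hκ => iInf₂_le _ ⟨κ, hκ, rfl⟩)
      (le_iInf₂ fun π ⟨κ, hκ, h⟩ => by subst h; exact iInf₂_le κ hκ)
  rw [wasserstein, h]
  change ENNReal.orderIsoRpow (1 / p) hp _ = _
  simp only [OrderIso.map_iInf]
  rfl

variable {E : Type*} [PseudoEMetricSpace E] [SecondCountableTopology E] [MeasurableSpace E]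
  [BorelSpace E]

/-- The triangle inequality for the costs of individual plans: Minkowski's inequality on the gluing
of `avg μ ⊗ₘ κ` and `avg ν ⊗ₘ η`, whose outer marginal comes from the kernel `η ∘ₖ κ`. -/
lemma wasserstein_le_add_of_mem_kernels [NeZero d] {p : ℝ} (hp : 1 ≤ p)
    {μ ν ξ : Fin d → ProbabilityMeasure E}
    {κ η : Kernel E E} (hκ : κ ∈ kernels μ ν) (hη : η ∈ kernels ν ξ) :
    wasserstein p μ ξ ≤ (∫⁻ z, edist z.1 z.2 ^ p ∂(avg μ ⊗ₘ κ)) ^ (1 / p)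
      + (∫⁻ z, edist z.1 z.2 ^ p ∂(avg ν ⊗ₘ η)) ^ (1 / p) := by
  have := hκ.1
  have := hη.1
  -- The gluing of the two plans along their common marginal `avg ν`.
  let M : Measure ((E × E) × E) := (avg μ ⊗ₘ κ) ⊗ₘ η.comap Prod.snd measurable_snd
  have h₁ : ∫⁻ w, edist w.1.1 w.1.2 ^ p ∂M = ∫⁻ z, edist z.1 z.2 ^ p ∂(avg μ ⊗ₘ κ) := by
    rw [Measure.lintegral_compProd (by fun_prop)]
    simp
  have h₂ : ∫⁻ w, edist w.1.2 w.2 ^ p ∂M = ∫⁻ z, edist z.1 z.2 ^ p ∂(avg ν ⊗ₘ η) := by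
    have hm : Measurable fun y => ∫⁻ z, edist y z ^ p ∂(η y) :=
      Measurable.lintegral_kernel_prod_right (f := fun y z => edist y z ^ p)
        (by unfold Function.uncurry; fun_prop)
    rw [Measure.lintegral_compProd (μ := avg ν) (by fun_prop),
      ← avg_bind_eq_of_mem_kernels hκ, Measure.lintegral_bind κ.aemeasurable hm.aemeasurable]
    exact (Measure.lintegral_compProd (by fun_prop)).trans
      (Measure.lintegral_compProd (μ := avg μ) (κ := κ)
        (f := fun a => ∫⁻ b, edist a.2 b ^ p ∂(η a.2)) (hm.comp measurable_snd))
  have h₃ : ∫⁻ w, edist w.1.1 w.2 ^ p ∂M = ∫⁻ z, edist z.1 z.2 ^ p ∂(avg μ ⊗ₘ (η ∘ₖ κ)) := by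
    have hm : Measurable fun a : E × E => ∫⁻ b, edist a.1 b ^ p ∂(η a.2) :=
      Measurable.lintegral_kernel_prod_right (f := fun a b => edist a.1 b ^ p)
        (κ := η.comap Prod.snd measurable_snd) (by unfold Function.uncurry; fun_prop)
    rw [Measure.lintegral_compProd (by fun_prop),
      Measure.lintegral_compProd (κ := η ∘ₖ κ) (by fun_prop)]
    refine (Measure.lintegral_compProd hm).trans (lintegral_congr fun x => ?_)
    exact (Kernel.lintegral_comp η κ x (g := fun y => edist x y ^ p) (by fun_prop)).symm
  calc wasserstein p μ ξ
      ≤ (∫⁻ w, edist w.1.1 w.2 ^ p ∂M) ^ (1 / p) := by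
        rw [h₃]
        exact ENNReal.rpow_le_rpow (iInf₂_le _ ⟨_, comp_mem_kernels hκ hη, rfl⟩) (by positivity)
    _ ≤ (∫⁻ w, (edist w.1.1 w.1.2 + edist w.1.2 w.2) ^ p ∂M) ^ (1 / p) := by
        gcongr
        exact edist_triangle _ _ _
    _ ≤ (∫⁻ w, edist w.1.1 w.1.2 ^ p ∂M) ^ (1 / p) + (∫⁻ w, edist w.1.2 w.2 ^ p ∂M) ^ (1 / p) :=
        ENNReal.lintegral_Lp_add_le (f := fun w : (E × E) × E => edist w.1.1 w.1.2)
          (g := fun w => edist w.1.2 w.2) (by fun_prop) (by fun_prop) hp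
    _ = _ := by rw [h₁, h₂]

lemma wasserstein_triangle [NeZero d] {p : ℝ} (hp : 1 ≤ p)
    (μ ν ξ : Fin d → ProbabilityMeasure E) :
    wasserstein p μ ξ ≤ wasserstein p μ ν + wasserstein p ν ξ := by
  rw [wasserstein_eq_iInf hp μ ν, wasserstein_eq_iInf hp ν ξ]
  simp only [ENNReal.iInf_add, ENNReal.add_iInf]
  exact le_iInf₂ fun η hη => le_iInf₂ fun κ hκ => wasserstein_le_add_of_mem_kernels hp hκ hη

/-! ### Positivity -/

lemma wasserstein_self [NeZero d] {p : ℝ} (hp : 1 ≤ p) (μ : Fin d → ProbabilityMeasure E) :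
    wasserstein p μ μ = 0 := by
  have hp0 : 0 < p := zero_lt_one.trans_le hp
  rw [← nonpos_iff_eq_zero, wasserstein_eq_iInf hp]
  refine (iInf₂_le Kernel.id ⟨inferInstance, fun j => ?_⟩).trans_eq ?_
  · rw [Measure.lintegral_compProd (by fun_prop)]
    have h (x : E) : ∫⁻ y, edist x y ^ p ∂((Kernel.id : Kernel E E) x) = 0 := by
      rw [Kernel.lintegral_id' (by fun_prop)]
      simp [hp0]
    simp [h, hp0]
  · simp

/-- If mass at distance `≥ δ` is at most `δ` along a coupling, then its marginals are `δ`-close in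
the Lévy-Prokhorov distance; Markov's inequality provides this from a bound on the cost. -/
lemma levyProkhorovEDist_fst_snd_le {p : ℝ} (hp : 0 ≤ p) (π : Measure (E × E)) {δ : ℝ≥0∞}
    (hδ : δ ≠ 0) (hδ' : δ ≠ ∞) (h : ∫⁻ z, edist z.1 z.2 ^ p ∂π ≤ δ ^ p * δ) :
    levyProkhorovEDist π.fst π.snd ≤ δ := by
  have hfar : π {z | δ ≤ edist z.1 z.2} ≤ δ := by
    have h1 := mul_meas_ge_le_lintegral (μ := π) (f := fun z : E × E => edist z.1 z.2 ^ p)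
      (by fun_prop) (δ ^ p)
    have h2 : π {z | δ ≤ edist z.1 z.2} ≤ π {z | δ ^ p ≤ edist z.1 z.2 ^ p} :=
      measure_mono fun z hz => ENNReal.rpow_le_rpow hz hp
    refine h2.trans ?_
    refine (ENNReal.mul_le_mul_iff_right (a := δ ^ p) ?_ ?_).1 (h1.trans h)
    · exact (ENNReal.rpow_pos (pos_iff_ne_zero.2 hδ) hδ').ne'
    · exact ENNReal.rpow_ne_top_of_nonneg hp hδ'
  refine levyProkhorovEDist_le_of_forall _ _ _ fun ε B hε hεt hB => ?_
  have hth : ∀ x ∈ B, ∀ y, edist x y < δ → y ∈ Metric.thickening ε.toReal B := fun x hx y hxy => by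
    rw [Metric.mem_thickening_iff_infEDist_lt, ENNReal.ofReal_toReal hεt.ne]
    exact (Metric.infEDist_le_edist_of_mem hx).trans_lt (by rw [edist_comm]; exact hxy.trans hε)
  rw [Measure.fst_apply hB, Measure.snd_apply hB,
    Measure.fst_apply Metric.isOpen_thickening.measurableSet,
    Measure.snd_apply Metric.isOpen_thickening.measurableSet]
  constructor
  · refine (measure_mono fun z hz => ?_).trans
      ((measure_union_le _ _).trans (add_le_add_right (hfar.trans hε.le) _))
    by_cases hd : edist z.1 z.2 < δ
    · exact Or.inl (hth _ hz _ hd)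
    · exact Or.inr (not_lt.1 hd)
  · refine (measure_mono fun z hz => ?_).trans
      ((measure_union_le _ _).trans (add_le_add_right (hfar.trans hε.le) _))
    by_cases hd : edist z.1 z.2 < δ
    · exact Or.inl (hth _ hz _ (by rwa [edist_comm]))
    · exact Or.inr (not_lt.1 hd)

lemma lintegral_compProd_le [NeZero d] (μ : Fin d → ProbabilityMeasure X) (κ : Kernel X Y)
    [IsMarkovKernel κ] (j : Fin d) {f : X × Y → ℝ≥0∞} (hf : Measurable f) :
    ∫⁻ z, f z ∂((μ j : Measure X) ⊗ₘ κ) ≤ d * ∫⁻ z, f z ∂(avg μ ⊗ₘ κ) := by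
  rw [Measure.lintegral_compProd hf, Measure.lintegral_compProd hf, ← smul_eq_mul,
    ← lintegral_smul_measure]
  exact lintegral_mono' (le_smul_avg μ j) le_rfl

/-- A kernel moving `avg μ` at small cost moves each `μ j` to `ν j` at a cost at most `d` times as
large, so `μ j` and `ν j` are at Lévy-Prokhorov distance zero. No optimal plan is needed. -/
lemma eq_of_wasserstein_eq_zero [NeZero d] {p : ℝ} (hp : 1 ≤ p)
    {μ ν : Fin d → ProbabilityMeasure E} (h : wasserstein p μ ν = 0) : μ = ν := by
  have hp0 : 0 < p := zero_lt_one.trans_le hp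
  have hd : (d : ℝ≥0∞) ≠ 0 := by simp [NeZero.ne d]
  have hcost : minCost (fun x y => edist x y ^ p) μ ν = 0 := by
    rwa [wasserstein, ENNReal.rpow_eq_zero_iff_of_pos (by positivity)] at h
  funext j
  have hLP : levyProkhorovEDist (μ j : Measure E) (ν j) = 0 := by
    rw [← nonpos_iff_eq_zero]
    refine ENNReal.le_of_forall_pos_le_add fun ε hε _ => ?_
    rw [zero_add]
    have hε' : (ε : ℝ≥0∞) ≠ 0 := by simpa using hε.ne'
    have hpos : minCost (fun x y => edist x y ^ p) μ ν < (ε : ℝ≥0∞) ^ p * ε / d := by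
      rw [hcost]
      exact ENNReal.div_pos (mul_ne_zero
        (ENNReal.rpow_pos (pos_iff_ne_zero.2 hε') ENNReal.coe_ne_top).ne' hε') (by simp)
    simp only [minCost, iInf_lt_iff] at hpos
    obtain ⟨_, ⟨κ, hκ, rfl⟩, hlt⟩ := hpos
    have := hκ.1
    have hle := levyProkhorovEDist_fst_snd_le hp0.le ((μ j : Measure E) ⊗ₘ κ) hε'
      ENNReal.coe_ne_top ((lintegral_compProd_le μ κ j (by fun_prop)).trans
        ((mul_le_mul_right hlt.le _).trans_eq (ENNReal.mul_div_cancel hd (by simp))))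
    rwa [Measure.fst_compProd, Measure.snd_compProd, bind_eq_of_mem_kernels hκ] at hle
  refine Subtype.ext (?_ : (μ j : Measure E) = ν j)
  refine ext_of_generate_finite {s : Set E | IsClosed s} ?_ isPiSystem_isClosed (fun A hA => ?_)
    (by simp)
  · rw [BorelSpace.measurable_eq (α := E), borel_eq_generateFrom_isClosed]
  · exact measure_eq_measure_of_levyProkhorovEDist_eq_zero_of_isClosed hLP hA
      ⟨1, one_pos, by finiteness⟩ ⟨1, one_pos, by finiteness⟩

/-! ### Finiteness -/

/-- A coupling has finite `p`-cost as soon as both of its marginals have finite `p`-th moments. -/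
lemma lintegral_edist_rpow_lt_top {X : Type*} [PseudoMetricSpace X] [SecondCountableTopology X]
    [MeasurableSpace X] [BorelSpace X] {p : ℝ} (hp : 1 ≤ p) {π : Measure (X × X)}
    [IsFiniteMeasure π] {x₀ x₁ : X} (h₀ : ∫⁻ x, edist x x₀ ^ p ∂π.fst < ∞)
    (h₁ : ∫⁻ x, edist x x₁ ^ p ∂π.snd < ∞) : ∫⁻ z, edist z.1 z.2 ^ p ∂π < ∞ := by
  have hp0 : 0 ≤ p := zero_le_one.trans hp
  rw [Measure.fst, lintegral_map (by fun_prop) measurable_fst] at h₀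
  rw [Measure.snd, lintegral_map (by fun_prop) measurable_snd] at h₁
  let C : ℝ≥0∞ := 2 ^ (p - 1)
  have hC : C ≠ ∞ := ENNReal.rpow_ne_top_of_nonneg (by linarith) (by simp)
  have hle (z : X × X) : edist z.1 z.2 ^ p ≤
      C * (edist z.1 x₀ ^ p + C * (edist x₀ x₁ ^ p + edist z.2 x₁ ^ p)) := calc
    edist z.1 z.2 ^ p ≤ (edist z.1 x₀ + (edist x₀ x₁ + edist z.2 x₁)) ^ p := by
      rw [edist_comm z.2 x₁]
      gcongr
      exact (edist_triangle _ x₀ _).trans (by gcongr; exact edist_triangle _ _ _)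
    _ ≤ C * (edist z.1 x₀ ^ p + (edist x₀ x₁ + edist z.2 x₁) ^ p) :=
      ENNReal.rpow_add_le_mul_rpow_add_rpow _ _ hp
    _ ≤ _ := by
      gcongr
      exact ENNReal.rpow_add_le_mul_rpow_add_rpow _ _ hp
  refine (lintegral_mono hle).trans_lt ?_
  rw [lintegral_const_mul _ (by fun_prop), lintegral_add_left (by fun_prop),
    lintegral_const_mul _ (by fun_prop), lintegral_add_left (by fun_prop), lintegral_const]
  have hx : edist x₀ x₁ ^ p ≠ ∞ := ENNReal.rpow_ne_top_of_nonneg hp0 (edist_ne_top _ _)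
  finiteness

lemma wasserstein_lt_top [NeZero d] {X : Type*} [PseudoMetricSpace X] [SecondCountableTopology X]
    [MeasurableSpace X] [BorelSpace X] {p : ℝ} (hp : 1 ≤ p) {μ ν : Fin d → ProbabilityMeasure X}
    (h : (plans μ ν).Nonempty) (hμ : μ ∈ finiteMoment X d p) (hν : ν ∈ finiteMoment X d p) :
    wasserstein p μ ν < ∞ := by
  obtain ⟨π, hπ⟩ := h
  obtain ⟨x₀, h₀⟩ := hμ
  obtain ⟨x₁, h₁⟩ := hν
  have : IsFiniteMeasure π :=
    ⟨by rw [← Measure.fst_univ, fst_of_mem_plans hπ]; exact measure_lt_top _ _⟩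
  rw [← fst_of_mem_plans hπ] at h₀
  rw [← snd_of_mem_plans hπ] at h₁
  exact ENNReal.rpow_lt_top_of_nonneg (by positivity)
    ((iInf₂_le π hπ).trans_lt (lintegral_edist_rpow_lt_top hp h₀ h₁)).ne

end SimTransport

theorem proposition5p8 {X : Type*} [MetricSpace X] [PolishSpace X] [MeasurableSpace X]
    [BorelSpace X] {d : ℕ} (hd : 1 ≤ d) :
    (∀ c : X → X → ℝ≥0∞, Continuous (fun z : X × X => c z.1 z.2) →
      (∀ x y, c x y = c y x) →
      ∀ μ ν : Fin d → ProbabilityMeasure X,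
        (SimTransport.plans μ ν).Nonempty → (SimTransport.plans ν μ).Nonempty →
        SimTransport.minCost c μ ν = SimTransport.minCost c ν μ) ∧
    (∀ p : ℝ, 1 ≤ p → ∀ P : ProbabilityMeasure (Fin d → ℝ≥0),
      ∀ μ ∈ SimTransport.eqClass X P, ∀ ν ∈ SimTransport.eqClass X P,
        SimTransport.wasserstein p μ ν = SimTransport.wasserstein p ν μ ∧
        (SimTransport.wasserstein p μ ν = 0 ↔ μ = ν) ∧
        (∀ ξ ∈ SimTransport.eqClass X P, SimTransport.wasserstein p μ ξ ≤
          SimTransport.wasserstein p μ ν + SimTransport.wasserstein p ν ξ) ∧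
        (μ ∈ SimTransport.finiteMoment X d p → ν ∈ SimTransport.finiteMoment X d p →
          SimTransport.wasserstein p μ ν < ∞)) := by
  have : NeZero d := ⟨by omega⟩
  refine ⟨fun c hc hsymm μ ν h h' => ?_, fun p hp P μ hμ ν hν => ⟨?_, ⟨?_, ?_⟩, ?_, ?_⟩⟩
  · exact le_antisymm
      (SimTransport.minCost_le_of_symm hc.measurable hsymm
        (SimTransport.lintegral_density_sq_le h))
      (SimTransport.minCost_le_of_symm hc.measurable hsymm
        (SimTransport.lintegral_density_sq_le h'))
  · have hle {μ ν : Fin d → ProbabilityMeasure X} (hμ : μ ∈ SimTransport.eqClass X P)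
        (hν : ν ∈ SimTransport.eqClass X P) :
        SimTransport.wasserstein p ν μ ≤ SimTransport.wasserstein p μ ν := by
      refine ENNReal.rpow_le_rpow (SimTransport.minCost_le_of_symm (by fun_prop)
        (fun x y => by rw [edist_comm]) fun j => ?_) (by positivity)
      rw [SimTransport.lintegral_density_sq_eq_of_mem_eqClass hμ,
        SimTransport.lintegral_density_sq_eq_of_mem_eqClass hν]
    exact le_antisymm (hle hν hμ) (hle hμ hν)
  · exact SimTransport.eq_of_wasserstein_eq_zero hp
  · rintro rfl
    exact SimTransport.wasserstein_self hp μ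
  · exact fun ξ _ => SimTransport.wasserstein_triangle hp μ ν ξ
  · exact SimTransport.wasserstein_lt_top hp (SimTransport.plans_nonempty_of_mem_eqClass hμ hν)
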